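/- **Setting.** Let $n\ge 0$, $d\ge 0$ be integers and $\alpha\in(0,1)$. Let $\{(X_i,Y_i)\}_{i\ge -n}$ be i.i.d. random pairs in $\mathbb R^d\times\mathbb R$; the pairs with $-n\le i\le -1$ are the initial labeled data, and those with $i\ge 0$ arrive online. Let $\widehat\mu:\mathbb R^d\to\mathbb R$ be a fixed (pre-trained) measurable function and $R_i=|Y_i-\widehat\mu(X_i)|$. For each $t\ge 0$ let $\Pi_t:\mathbb R^d\to\{0,1\}$ be a random (measurable) selection rule and $S_t=\Pi_t(X_t)$. Assume that the selection is decision-driven, i.e. for every $t\ge0$ the rule $\Pi_t(\cdot)$ is measurable with respect to $\sigma(S_0,\dots,S_{t-1})$, and that $\{\Pi_t(\cdot)\}_{t\ge 0}$ is independent of $\{(X_i,Y_i)\}_{i=-n}^{-1}$. Using the full holdout set $\{-n,\dots,t-1\}$ and the nonadaptive pick rule $\Pi_t$, put $$\widehat{\mathcal C}_t=\{s:-n\le s\le t-1,\ \Pi_t(X_s)=1\},\qquad \mathcal I_t=\{y\in\mathbb R:\ |y-\widehat\mu(X_t)|\le q_t\},$$ where $q_t$ is the $\lceil(1-\alpha)(|\widehat{\mathcal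 C}_t|+1)\rceil$-th smallest value in $\{R_i\}_{i\in\widehat{\mathcal C}_t}$ (counted with multiplicity), and $q_t=\infty$ if there are fewer values than that. Let $$\operatorname{FCR}(T)=\mathbb E\left[\frac{\sum_{t=0}^T S_t\,\mathbf 1\{Y_t\notin\mathcal I_t\}}{1\vee\sum_{j=0}^T S_j}\right].$$ Let $Q_t$ be the $\lceil(1-\alpha)(|\widehat{\mathcal C}_t|+1)\rceil$-th smallest value in $\{R_i\}_{i\in\widehat{\mathcal C}_t\cup\{t\}}$, and define $$\Delta_t=\sum_{s=0}^{t-1}\frac{\Pi_t(X_s)\,\mathbf 1\{\Pi_s(X_t)\ne\Pi_s(X_s)\}}{|\widehat{\mathcal C}_t|+1}\Bigl(\mathbf 1\{R_t>Q_t\}-\mathbf 1\{R_s>Q_t\}\Bigr).$$ **Theorem.** For every $T\ge 0$, $$\operatorname{FCR}(T)\le\alpha+\sum_{t=0}^T\mathbb E\left[\frac{S_t\Delta_t}{1\vee\sum_{j=0}^T S_j}\right],$$ and for every $t\ge 0$ with $\mathbb P(S_t=1)>0$, $$\mathbb P\{Y_t\in\mathcal I_t\mid S_t=1\}\ge 1-\alpha-\frac{\mathbb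 E[S_t\Delta_t]}{\mathbb P(S_t=1)}.$$ -/

import Mathlib

open MeasureTheory ProbabilityTheory

noncomputable section

namespace CAP

/-- The feature space `ℝ^d`. -/
abbrev Feature (d : ℕ) : Type := EuclideanSpace ℝ (Fin d)

variable {Ω : Type*} {d : ℕ}

/-! Conventions: the data `(X i, Y i)` carry integer indices `i ≥ -n`; the indices `-n, …, -1` are the
initial labeled data and `0, 1, 2, …` are the online data. A selection rule `Π_t` is a random
`{0,1}`-valued function on the feature space, `rule t ω : Feature d → Bool`, with `true` for `1`. -/

/-- The decision `S_t = Π_t(X_t)`. -/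
def decision (rule : ℕ → Ω → Feature d → Bool) (X : ℤ → Ω → Feature d) (t : ℕ) (ω : Ω) : Bool :=
  rule t ω (X t ω)

/-- A truth value as the real number `0` or `1`. -/
def ind (b : Bool) : ℝ := if b = true then 1 else 0

/-- The `σ`-field generated by the decisions `S_0, …, S_{t-1}`. -/
abbrev decisionSigma (rule : ℕ → Ω → Feature d → Bool) (X : ℤ → Ω → Feature d) (t : ℕ) :
    MeasurableSpace Ω :=
  ⨆ i : Fin t, MeasurableSpace.comap (decision rule X i) ⊤

/-- Decision-driven selection: for every `t`, the random function `Π_t(·)` is measurable with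
respect to the `σ`-field generated by `S_0, …, S_{t-1}`. -/
def DecisionDriven (rule : ℕ → Ω → Feature d → Bool) (X : ℤ → Ω → Feature d) : Prop :=
  ∀ (t : ℕ) (x : Feature d), Measurable[decisionSigma rule X t] (fun ω => rule t ω x)

/-- The family of selection rules `{Π_t(·)}_{t ≥ 0}` is independent of the initial labeled data
`{(X_i, Y_i)}_{i = -n}^{-1}`. -/
def IndepOfInitial [MeasurableSpace Ω] (μ : Measure Ω) (n : ℕ) (X : ℤ → Ω → Feature d)
    (Y : ℤ → Ω → ℝ) (rule : ℕ → Ω → Feature d → Bool) : Prop :=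
  Indep
    (⨆ t : ℕ, ⨆ x : Feature d, MeasurableSpace.comap (fun ω => rule t ω x) ⊤)
    (⨆ i : Set.Ico (-(n : ℤ)) 0,
      MeasurableSpace.comap (fun ω => (X i ω, Y i ω)) Prod.instMeasurableSpace) μ

/-- The residual `R_i = |Y_i - μ̂(X_i)|`. -/
def residual (muHat : Feature d → ℝ) (X : ℤ → Ω → Feature d) (Y : ℤ → Ω → ℝ) (i : ℤ) (ω : Ω) : ℝ :=
  |Y i ω - muHat (X i ω)|

/-- The `k`-th smallest value (with multiplicity) of the family `(R i)_{i ∈ C}`, for `k ≥ 1`: the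
least level `r` such that at least `k` members of the family are `≤ r`. It is `⊤ = ∞` if the family
has fewer than `k` members. -/
def kthSmallest (R : ℤ → ℝ) (C : Finset ℤ) (k : ℕ) : EReal :=
  sInf {r : EReal | k ≤ (C.filter (fun i => (R i : EReal) ≤ r)).card}

/-- The rank `⌈(1 - α)(m + 1)⌉`. -/
def conformalRank (α : ℝ) (m : ℕ) : ℕ := ⌈(1 - α) * ((m : ℝ) + 1)⌉₊

/-- The holdout indices `{-n, …, t-1}`. -/
def holdout (n t : ℕ) : Finset ℤ := Finset.Ico (-(n : ℤ)) (t : ℤ)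

/-- The calibration set picked from the full holdout set `{-n, …, t-1}` by pick rules `Π_{t,s}`. -/
def calibrationSet (n : ℕ) (X : ℤ → Ω → Feature d) (pick : ℕ → ℤ → Ω → Feature d → Bool)
    (t : ℕ) (ω : Ω) : Finset ℤ :=
  (holdout n t).filter (fun s => pick t s ω (X s ω) = true)

/-- The nonadaptive pick rules `Π_{t,s} = Π_t`. -/
def nonadaptivePick (rule : ℕ → Ω → Feature d → Bool) : ℕ → ℤ → Ω → Feature d → Bool :=
  fun t _ => rule t

/-- The interval `μ̂(X_t) ± q`, where `q` is the `⌈(1 - α)(|C| + 1)⌉`-th smallest residual over the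
calibration set `C` picked at time `t`; it is the whole line if `q = ∞`. -/
def interval (n : ℕ) (α : ℝ) (muHat : Feature d → ℝ) (X : ℤ → Ω → Feature d) (Y : ℤ → Ω → ℝ)
    (pick : ℕ → ℤ → Ω → Feature d → Bool) (t : ℕ) (ω : Ω) : Set ℝ :=
  let C := calibrationSet n X pick t ω
  let q := kthSmallest (fun i => residual muHat X Y i ω) C (conformalRank α C.card)
  {y : ℝ | (muHat (X t ω) : EReal) - q ≤ (y : EReal) ∧ (y : EReal) ≤ (muHat (X t ω) : EReal) + q}

open Classical in
/-- The false coverage proportion up to time `T` of the intervals `I_t`. -/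
def FCP (rule : ℕ → Ω → Feature d → Bool) (X : ℤ → Ω → Feature d) (Y : ℤ → Ω → ℝ)
    (I : ℕ → Ω → Set ℝ) (T : ℕ) (ω : Ω) : ℝ :=
  (∑ t ∈ Finset.range (T + 1), ind (decision rule X t ω) * (if Y t ω ∉ I t ω then 1 else 0)) /
    max 1 (∑ j ∈ Finset.range (T + 1), ind (decision rule X j ω))

/-- The false coverage-statement rate up to time `T`. -/
def FCR [MeasurableSpace Ω] (μ : Measure Ω) (rule : ℕ → Ω → Feature d → Bool)
    (X : ℤ → Ω → Feature d) (Y : ℤ → Ω → ℝ) (I : ℕ → Ω → Set ℝ) (T : ℕ) : ℝ :=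
  ∫ ω, FCP rule X Y I T ω ∂μ

open Classical in
/-- The error term
`Δ_t = ∑_{s=0}^{t-1} Π_t(X_s) 1{Π_s(X_t) ≠ Π_s(X_s)} / (|C| + 1) * (1{R_t > Q} - 1{R_s > Q})`,
where `C` is the nonadaptively picked calibration set at time `t` and `Q` is the
`⌈(1 - α)(|C| + 1)⌉`-th smallest residual over `C ∪ {t}`. -/
def errorTerm (n : ℕ) (α : ℝ) (muHat : Feature d → ℝ) (X : ℤ → Ω → Feature d) (Y : ℤ → Ω → ℝ)
    (rule : ℕ → Ω → Feature d → Bool) (t : ℕ) (ω : Ω) : ℝ :=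
  let C := calibrationSet n X (nonadaptivePick rule) t ω
  let R := fun i => residual muHat X Y i ω
  let Q := kthSmallest R (insert (t : ℤ) C) (conformalRank α C.card)
  ∑ s ∈ Finset.range t,
    (ind (rule t ω (X s ω)) * (if rule s ω (X t ω) ≠ rule s ω (X s ω) then 1 else 0)) /
        ((C.card : ℝ) + 1) *
      ((if (R t : EReal) > Q then 1 else 0) - (if (R s : EReal) > Q then 1 else 0))

end CAP

end

noncomputable section

namespace CAP


/-! Let `k` be the conformal rank for the calibration set `C` at time `t`, and `Q` the `k`-th
smallest residual over `C ∪ {t}`. Miscoverage at `t` means `R t > Q`, and counting alone shows that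
at most `α (|C| + 1)` members of `C ∪ {t}` exceed `Q`. Hence the miscoverage indicator is at most
`α` plus the average, with denominator `|C| + 1`, of the differences 1{R_t > Q} - 1{R_s > Q} over `s
∈ C` (`exceeds_le`).

The points `s ≥ 0` at which `Π_s` separates `X_s` from `X_t` make up the error term. For every other
`s ∈ C`, on `S_t = 1`, exchanging the data at `s` and `t` alters no decision: at time `s` by
assumption, at time `t` because `Π_t` selects both features. The rules are functions of past
decisions, so they do not change either (`Swappable.rule_eq`), nor do `C` and `Q`, and the
difference changes sign (`exchTerm_swap`). The swap preserves the law of i.i.d. data, so these terms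
have mean zero under any weight depending on the decisions alone (`integral_exchTerm_eq_zero`). The
weight 1/(1 ∨ ∑ S_j) gives the FCR bound, the weight 1 the conditional coverage. -/

/-! ### Order statistics and the conformal rank -/

/-- Strict comparison with a real level turns the infimum into a count. For the converse, the
largest member below `x` serves as the level. -/
lemma lt_kthSmallest_iff (R : ℤ → ℝ) (C : Finset ℤ) (k : ℕ) (x : ℝ) :
    kthSmallest R C k < (x : EReal) ↔ k ≤ (C.filter (fun j => R j < x)).card := by
  unfold kthSmallest
  rw [sInf_lt_iff]
  constructor
  · rintro ⟨r, hr, hrx⟩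
    refine le_trans hr (Finset.card_le_card fun j hj => ?_)
    rw [Finset.mem_filter] at hj ⊢
    exact ⟨hj.1, EReal.coe_lt_coe_iff.1 (hj.2.trans_lt hrx)⟩
  · intro h
    rcases (C.filter (fun j => R j < x)).eq_empty_or_nonempty with h0 | h0
    · rw [h0, Finset.card_empty] at h
      -- Here `k = 0`, and every level qualifies, `⊥` included.
      exact ⟨⊥, by simp only [Set.mem_ofPred_eq]; omega, EReal.bot_lt_coe x⟩
    · obtain ⟨i, hi, hmax⟩ := Finset.exists_max_image _ R h0
      refine ⟨(R i : EReal), ?_, EReal.coe_lt_coe_iff.2 (Finset.mem_filter.1 hi).2⟩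
      refine le_trans h (Finset.card_le_card fun j hj => ?_)
      exact Finset.mem_filter.2 ⟨(Finset.mem_filter.1 hj).1, EReal.coe_le_coe_iff.2 (hmax j hj)⟩

/-- `R t` is not strictly below itself, so adding `t` leaves the count unchanged. Thus the threshold
defining the interval may be replaced by one symmetric in `C ∪ {t}`. -/
lemma kthSmallest_insert_lt_iff (R : ℤ → ℝ) (C : Finset ℤ) (k : ℕ) (t : ℤ) :
    kthSmallest R (insert t C) k < (R t : EReal) ↔ kthSmallest R C k < (R t : EReal) := by
  rw [lt_kthSmallest_iff, lt_kthSmallest_iff, Finset.filter_insert, if_neg (lt_irrefl _)]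

/-- At most `|C| - k` members of a finite family exceed its `k`-th smallest value. -/
lemma card_gt_kthSmallest_add_le (R : ℤ → ℝ) (C : Finset ℤ) (k : ℕ) (hk : k ≤ C.card) :
    (C.filter (fun i => kthSmallest R C k < (R i : EReal))).card + k ≤ C.card := by
  set A := C.filter (fun i => kthSmallest R C k < (R i : EReal)) with hA
  rcases A.eq_empty_or_nonempty with h0 | h0
  · simpa [h0] using hk
  -- Let `R i` be the least value above the threshold. At least `k` members lie strictly below it,
  -- and by minimality none of them is in `A`.
  · obtain ⟨i, hi, hmin⟩ := Finset.exists_min_image _ R h0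
    have h1 := (lt_kthSmallest_iff R C k (R i)).1 (Finset.mem_filter.1 hi).2
    have hd : Disjoint A (C.filter (fun j => R j < R i)) := by
      rw [Finset.disjoint_left]
      intro j hj hj'
      exact absurd (Finset.mem_filter.1 hj').2 (not_lt.2 (hmin j hj))
    calc A.card + k ≤ A.card + (C.filter (fun j => R j < R i)).card := by omega
      _ = (A ∪ C.filter (fun j => R j < R i)).card := (Finset.card_union_of_disjoint hd).symm
      _ ≤ C.card := Finset.card_le_card
          (Finset.union_subset (Finset.filter_subset _ _) (Finset.filter_subset _ _))

/-- At every level, `σ` maps one set of counted indices bijectively onto the other. -/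
lemma kthSmallest_comp_perm (R : ℤ → ℝ) (C : Finset ℤ) (k : ℕ) (σ : Equiv.Perm ℤ)
    (hσ : ∀ i, σ i ∈ C ↔ i ∈ C) :
    kthSmallest (fun i => R (σ i)) C k = kthSmallest R C k := by
  have h : ∀ r : EReal, (C.filter (fun i => (R (σ i) : EReal) ≤ r)).card =
      (C.filter (fun i => (R i : EReal) ≤ r)).card := fun r =>
    Finset.card_equiv σ fun i => by simp [hσ]
  simp only [kthSmallest, h]

lemma kthSmallest_congr {R R' : ℤ → ℝ} {C : Finset ℤ} (h : ∀ i ∈ C, R i = R' i) (k : ℕ) :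
    kthSmallest R C k = kthSmallest R' C k := by
  have h : ∀ r : EReal, C.filter (fun i => (R i : EReal) ≤ r) =
      C.filter (fun i => (R' i : EReal) ≤ r) := fun r =>
    Finset.filter_congr fun i hi => by rw [h i hi]
  simp only [kthSmallest, h]

lemma conformalRank_le {α : ℝ} (hα : 0 ≤ α) (m : ℕ) : conformalRank α m ≤ m + 1 := by
  unfold conformalRank
  rw [Nat.ceil_le]
  push_cast
  nlinarith [(Nat.cast_nonneg m : (0 : ℝ) ≤ m)]

lemma le_conformalRank (α : ℝ) (m : ℕ) : (1 - α) * ((m : ℝ) + 1) ≤ conformalRank α m :=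
  Nat.le_ceil _

/-- Stated for extended real `q`, so that infinite thresholds need no separate treatment later. -/
lemma mem_symmetric_interval_iff (y m : ℝ) (q : EReal) :
    ((m : EReal) - q ≤ (y : EReal) ∧ (y : EReal) ≤ (m : EReal) + q) ↔
      ¬ q < ((|y - m| : ℝ) : EReal) := by
  induction q with
  | bot => simp
  | top => simp
  | coe q =>
    rw [not_lt, EReal.coe_le_coe_iff, ← EReal.coe_sub, ← EReal.coe_add, EReal.coe_le_coe_iff,
      EReal.coe_le_coe_iff, abs_le]
    constructor <;> rintro ⟨h1, h2⟩ <;> constructor <;> linarith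

lemma ind_nonneg (b : Bool) : 0 ≤ ind b := by cases b <;> simp [ind]

lemma ind_le_one (b : Bool) : ind b ≤ 1 := by cases b <;> simp [ind]

/-! ### Pathwise decomposition of the miscoverage -/

section Pathwise

variable {Ω : Type*} {d : ℕ} (n : ℕ) (α : ℝ) (muHat : Feature d → ℝ) (X : ℤ → Ω → Feature d)
  (Y : ℤ → Ω → ℝ) (rule : ℕ → Ω → Feature d → Bool)

open Classical in
/-- The indicator that the `i`-th residual exceeds the conformal threshold over the calibration set
at time `t` augmented by `t`. -/
def exceeds (t : ℕ) (i : ℤ) (ω : Ω) : ℝ :=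
  let C := calibrationSet n X (nonadaptivePick rule) t ω
  if (residual muHat X Y i ω : EReal) >
    kthSmallest (fun i => residual muHat X Y i ω) (insert (t : ℤ) C) (conformalRank α C.card)
  then 1 else 0

/-- The event that exchanging the data at times `s` and `t` preserves all decisions, given
that `s` is a calibration point at time `t` and `t` is selected. -/
def Swappable (t : ℕ) (s : ℤ) (ω : Ω) : Prop :=
  rule t ω (X s ω) = true ∧ (0 ≤ s → rule s.toNat ω (X t ω) = rule s.toNat ω (X s ω))

open Classical in
/-- The contribution to the miscoverage at time `t` of a calibration point exchangeable with `t`. -/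
def exchTerm (t : ℕ) (s : ℤ) (ω : Ω) : ℝ :=
  (if Swappable X rule t s ω then 1 else 0) /
      (((calibrationSet n X (nonadaptivePick rule) t ω).card : ℝ) + 1) *
    (exceeds n α muHat X Y rule t t ω - exceeds n α muHat X Y rule t s ω)

lemma mem_interval_iff (t : ℕ) (ω : Ω) :
    Y t ω ∈ interval n α muHat X Y (nonadaptivePick rule) t ω ↔
      exceeds n α muHat X Y rule t t ω = 0 := by
  have h := kthSmallest_insert_lt_iff (fun i => residual muHat X Y i ω)
    (calibrationSet n X (nonadaptivePick rule) t ω)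
    (conformalRank α (calibrationSet n X (nonadaptivePick rule) t ω).card) t
  simp only [interval, Set.mem_ofPred_eq, mem_symmetric_interval_iff, exceeds, gt_iff_lt, h]
  simp only [residual]
  split_ifs with h' <;> simp [h']

lemma exceeds_nonneg (t : ℕ) (i : ℤ) (ω : Ω) : 0 ≤ exceeds n α muHat X Y rule t i ω := by
  unfold exceeds; dsimp only; split_ifs <;> norm_num

lemma exceeds_le_one (t : ℕ) (i : ℤ) (ω : Ω) : exceeds n α muHat X Y rule t i ω ≤ 1 := by
  unfold exceeds; dsimp only; split_ifs <;> norm_num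

lemma exceeds_self_eq (t : ℕ) (ω : Ω) [Decidable (Y t ω ∉ interval n α muHat X Y
    (nonadaptivePick rule) t ω)] :
    exceeds n α muHat X Y rule t t ω =
      if Y t ω ∉ interval n α muHat X Y (nonadaptivePick rule) t ω then 1 else 0 := by
  rw [← ite_not]
  simp only [mem_interval_iff, not_not]
  split_ifs with h
  · exact h
  · revert h
    unfold exceeds; dsimp only; split_ifs <;> simp

lemma not_mem_calibrationSet (t : ℕ) (ω : Ω) :
    (t : ℤ) ∉ calibrationSet n X (nonadaptivePick rule) t ω := by
  simp [calibrationSet, holdout]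

/-- At most `|C| + 1 - k` of the `|C| + 1` residuals exceed their `k`-th smallest value, and the
rank `k` is at least `(1 - α)(|C| + 1)`. No probability enters. -/
lemma sum_exceeds_le (hα0 : 0 ≤ α) (t : ℕ) (ω : Ω) :
    exceeds n α muHat X Y rule t t ω +
      ∑ s ∈ calibrationSet n X (nonadaptivePick rule) t ω, exceeds n α muHat X Y rule t s ω ≤
      α * (((calibrationSet n X (nonadaptivePick rule) t ω).card : ℝ) + 1) := by
  have hn := not_mem_calibrationSet n X rule t ω
  rw [← Finset.sum_insert (f := fun s => exceeds n α muHat X Y rule t s ω) hn]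
  unfold exceeds
  dsimp only
  set C := calibrationSet n X (nonadaptivePick rule) t ω
  have hc : (insert (t : ℤ) C).card = C.card + 1 := Finset.card_insert_of_notMem hn
  have h := card_gt_kthSmallest_add_le (fun i => residual muHat X Y i ω) (insert (t : ℤ) C)
    (conformalRank α C.card) (by rw [hc]; exact conformalRank_le hα0 _)
  rw [hc] at h
  rw [Finset.sum_boole]
  have h2 := le_conformalRank α C.card
  have h3 : ((Finset.filter (fun i => kthSmallest (fun i => residual muHat X Y i ω)
    (insert (t : ℤ) C) (conformalRank α C.card) < (residual muHat X Y i ω : EReal))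
    (insert (t : ℤ) C)).card : ℝ) + conformalRank α C.card ≤ C.card + 1 := by exact_mod_cast h
  simp only [gt_iff_lt]
  linarith

lemma sum_calibrationSet_eq (f : ℤ → ℝ) (t : ℕ) (ω : Ω) :
    ∑ s ∈ calibrationSet n X (nonadaptivePick rule) t ω, f s =
      ∑ s ∈ holdout n t, ind (rule t ω (X s ω)) * f s := by
  rw [calibrationSet, Finset.sum_filter]
  refine Finset.sum_congr rfl fun s _ => ?_
  by_cases h : rule t ω (X s ω) = true <;> simp [ind, nonadaptivePick, h]

lemma sum_range_eq_sum_holdout (f : ℤ → ℝ) (t : ℕ) :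
    ∑ s ∈ Finset.range t, f s = ∑ s ∈ holdout n t, if 0 ≤ s then f s else 0 := by
  rw [← Finset.sum_filter]
  refine Finset.sum_bij (fun s _ => (s : ℤ)) ?_ ?_ ?_ ?_
  · intro s hs
    simp only [holdout, Finset.mem_filter, Finset.mem_Ico, Finset.mem_range] at *
    omega
  · intro a _ b _ h
    exact_mod_cast h
  · intro s hs
    simp only [holdout, Finset.mem_filter, Finset.mem_Ico, Finset.mem_range] at *
    exact ⟨s.toNat, by omega, by omega⟩
  · intros; rfl

/-- Pathwise decomposition of the miscoverage. -/
lemma exceeds_le (hα0 : 0 ≤ α) (t : ℕ) (ω : Ω) :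
    exceeds n α muHat X Y rule t t ω ≤ α + errorTerm n α muHat X Y rule t ω +
      ∑ s ∈ holdout n t, exchTerm n α muHat X Y rule t s ω := by
  have hpos : (0 : ℝ) < ((calibrationSet n X (nonadaptivePick rule) t ω).card : ℝ) + 1 := by
    positivity
  have h1 := sum_exceeds_le n α muHat X Y rule hα0 t ω
  -- The two sums partition the calibration points. Negative `s` all fall into the exchangeable
  -- part, since no decision is made at those times.
  have h2 : errorTerm n α muHat X Y rule t ω +
      ∑ s ∈ holdout n t, exchTerm n α muHat X Y rule t s ω =
      (∑ s ∈ calibrationSet n X (nonadaptivePick rule) t ω,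
        (exceeds n α muHat X Y rule t t ω - exceeds n α muHat X Y rule t s ω)) /
        (((calibrationSet n X (nonadaptivePick rule) t ω).card : ℝ) + 1) := by
    have h3 : errorTerm n α muHat X Y rule t ω = ∑ s ∈ Finset.range t,
        (ind (rule t ω (X s ω)) *
          (if rule (s : ℤ).toNat ω (X t ω) ≠ rule (s : ℤ).toNat ω (X s ω) then 1 else 0)) /
        (((calibrationSet n X (nonadaptivePick rule) t ω).card : ℝ) + 1) *
        (exceeds n α muHat X Y rule t t ω - exceeds n α muHat X Y rule t s ω) := by
      unfold errorTerm exceeds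
      simp only [Int.toNat_natCast]
    rw [h3, sum_range_eq_sum_holdout n (fun s => (ind (rule t ω (X s ω)) *
          (if rule (s : ℤ).toNat ω (X t ω) ≠ rule (s : ℤ).toNat ω (X s ω) then 1 else 0)) /
        (((calibrationSet n X (nonadaptivePick rule) t ω).card : ℝ) + 1) *
        (exceeds n α muHat X Y rule t t ω - exceeds n α muHat X Y rule t s ω)),
      ← Finset.sum_add_distrib, sum_calibrationSet_eq, Finset.sum_div]
    refine Finset.sum_congr rfl fun s _ => ?_
    unfold exchTerm Swappable
    by_cases hs : 0 ≤ s <;> by_cases hr : rule t ω (X s ω) = true <;>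
      by_cases he : rule s.toNat ω (X t ω) = rule s.toNat ω (X s ω) <;>
      simp [hs, hr, he, ind] <;> ring
  rw [Finset.sum_sub_distrib, Finset.sum_const, nsmul_eq_mul] at h2
  rw [add_assoc, h2, ← sub_le_iff_le_add', le_div_iff₀ hpos]
  linarith

end Pathwise


/-! ### Rules as deterministic functions of past decisions -/

section Driven

variable {Ω Ω' : Type*} {d : ℕ} {X : ℤ → Ω → Feature d} {rule : ℕ → Ω → Feature d → Bool}
  {X' : ℤ → Ω' → Feature d} {rule' : ℕ → Ω' → Feature d → Bool}
  {g : ∀ t : ℕ, (Fin t → Bool) → Feature d → Bool}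

/-- The rule at time `t` is the deterministic function `g t` of the previous decisions. -/
def DrivenBy (g : ∀ t : ℕ, (Fin t → Bool) → Feature d → Bool) (rule : ℕ → Ω → Feature d → Bool)
    (X : ℤ → Ω → Feature d) : Prop :=
  ∀ t ω, rule t ω = g t (fun i => decision rule X i ω)

/-- Measurability with respect to the σ-field of the history makes `rule t · x` constant on each set
of equal history, for every `x`. So each `g t b` can be taken to be one realised rule, which is
measurable by `hrule`. -/
lemma DecisionDriven.exists_drivenBy (hdriven : DecisionDriven rule X)
    (hrule : ∀ t ω, Measurable (rule t ω)) :
    ∃ g : ∀ t : ℕ, (Fin t → Bool) → Feature d → Bool,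
      (∀ t b, Measurable (g t b)) ∧ DrivenBy g rule X := by
  classical
  let hist : ∀ t : ℕ, Ω → (Fin t → Bool) := fun t ω i => decision rule X i ω
  have hfac : ∀ t ω ω', hist t ω = hist t ω' → rule t ω = rule t ω' := by
    intro t ω ω' h
    funext x
    have hle : decisionSigma rule X t ≤ MeasurableSpace.comap (hist t) MeasurableSpace.pi := by
      refine iSup_le fun i => ?_
      rw [← measurable_iff_comap_le]
      exact (measurable_pi_apply i).comp (comap_measurable (hist t))
    exact Measurable.factorsThrough ((hdriven t x).mono hle le_rfl) h
  -- Histories that never occur get the constant rule `false`.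
  refine ⟨fun t b => if h : ∃ ω, hist t ω = b then rule t h.choose else fun _ => false, ?_, ?_⟩
  · intro t b
    dsimp only
    split_ifs with h
    · exact hrule t _
    · exact measurable_const
  · intro t ω
    have h : ∃ ω', hist t ω' = hist t ω := ⟨ω, rfl⟩
    change rule t ω = if h : ∃ ω', hist t ω' = hist t ω then rule t h.choose else fun _ => false
    rw [dif_pos h]
    exact (hfac t _ _ h.choose_spec).symm

/-- The decisions generated from a sequence of features by deterministic rules. -/
def replay (g : ∀ t : ℕ, (Fin t → Bool) → Feature d → Bool) (x : ℕ → Feature d) (t : ℕ) : Bool :=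
  g t (fun i : Fin t => replay g x i) (x t)
termination_by t
decreasing_by exact i.2

/-- The random rules generated by deterministic functions of the past decisions. -/
def replayRule (g : ∀ t : ℕ, (Fin t → Bool) → Feature d → Bool) (X : ℤ → Ω → Feature d)
    (t : ℕ) (ω : Ω) : Feature d → Bool :=
  g t (fun i : Fin t => replay g (fun j => X j ω) i)

lemma drivenBy_replayRule (g : ∀ t : ℕ, (Fin t → Bool) → Feature d → Bool)
    (X : ℤ → Ω → Feature d) : DrivenBy g (replayRule g X) X := by
  intro t ω
  have h : ∀ i : ℕ, decision (replayRule g X) X i ω = replay g (fun j => X j ω) i := by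
    intro i
    rw [replay]
    rfl
  simp only [h]
  rfl

/-- Replacing the features without changing any decision does not change the rules. -/
lemma DrivenBy.rule_eq (h : DrivenBy g rule X) (h' : DrivenBy g rule' X') {ω : Ω} {ω' : Ω'}
    (hst : ∀ j : ℕ, rule j ω (X' j ω') = rule j ω (X j ω)) (j : ℕ) : rule' j ω' = rule j ω := by
  induction j using Nat.strong_induction_on with
  | _ j ih =>
    rw [h, h']
    congr 1
    funext i
    unfold decision
    -- By induction the new rule at time `i` is the old one, and `hst` compares the old rule at the
    -- new and old features.
    rw [ih i i.2, hst]

/-- There are finitely many histories, so `g t` is jointly measurable in history and feature. The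
history is measurable by induction, applied with `f` equal to the earlier features. -/
lemma DrivenBy.measurable_rule_apply [MeasurableSpace Ω] (h : DrivenBy g rule X)
    (hg : ∀ t b, Measurable (g t b)) (hX : ∀ t : ℕ, Measurable (X t)) (t : ℕ) {f : Ω → Feature d}
    (hf : Measurable f) : Measurable (fun ω => rule t ω (f ω)) := by
  induction t using Nat.strong_induction_on generalizing f with
  | _ t ih =>
    have h1 : Measurable (fun p : (Fin t → Bool) × Feature d => g t p.1 p.2) :=
      measurable_from_prod_countable_right fun b => hg t b
    have h2 : Measurable (fun ω => ((fun i : Fin t => decision rule X i ω), f ω)) :=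
      (measurable_pi_lambda _ fun i : Fin t => ih i i.2 (hX i)).prodMk hf
    have h3 := h1.comp h2
    convert h3 using 1
    funext ω
    simp only [Function.comp, h t ω]

end Driven

/-! ### Effect of exchanging two data points -/

section Exchange

variable {Ω Ω' : Type*} {d : ℕ} {n : ℕ} {α : ℝ} {muHat : Feature d → ℝ} {X : ℤ → Ω → Feature d}
  {Y : ℤ → Ω → ℝ} {rule : ℕ → Ω → Feature d → Bool}
  {X' : ℤ → Ω' → Feature d} {Y' : ℤ → Ω' → ℝ} {rule' : ℕ → Ω' → Feature d → Bool}

lemma errorTerm_eq (t : ℕ) (ω : Ω) : errorTerm n α muHat X Y rule t ω =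
    ∑ s ∈ Finset.range t, (ind (rule t ω (X s ω)) *
          (if rule s ω (X t ω) ≠ rule s ω (X s ω) then 1 else 0)) /
        (((calibrationSet n X (nonadaptivePick rule) t ω).card : ℝ) + 1) *
        (exceeds n α muHat X Y rule t t ω - exceeds n α muHat X Y rule t s ω) := by
  rfl

/-- The threshold is a symmetric function of the residuals over `C ∪ {t}`; if `σ` preserves this
set, only the compared index moves. -/
lemma exceeds_perm {t : ℕ} {ω : Ω} {ω' : Ω'} {σ : Equiv.Perm ℤ}
    (hX : ∀ i, -(n : ℤ) ≤ i → X' i ω' = X (σ i) ω) (hY : ∀ i, -(n : ℤ) ≤ i → Y' i ω' = Y (σ i) ω)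
    (hC : calibrationSet n X' (nonadaptivePick rule') t ω' =
      calibrationSet n X (nonadaptivePick rule) t ω)
    (hσ : ∀ i, σ i ∈ insert (t : ℤ) (calibrationSet n X (nonadaptivePick rule) t ω) ↔
      i ∈ insert (t : ℤ) (calibrationSet n X (nonadaptivePick rule) t ω))
    {i : ℤ} (hi : -(n : ℤ) ≤ i) :
    exceeds n α muHat X' Y' rule' t i ω' = exceeds n α muHat X Y rule t (σ i) ω := by
  have hR : ∀ i, -(n : ℤ) ≤ i → residual muHat X' Y' i ω' = residual muHat X Y (σ i) ω :=
    fun i hi => by rw [residual, residual, hX i hi, hY i hi]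
  unfold exceeds
  dsimp only
  rw [hC, hR i hi, ← kthSmallest_comp_perm (fun i => residual muHat X Y i ω) _ _ σ hσ,
    kthSmallest_congr (R := fun i => residual muHat X' Y' i ω')
      (R' := fun i => residual muHat X Y (σ i) ω)]
  intro j hj
  refine hR j ?_
  rw [Finset.mem_insert] at hj
  rcases hj with rfl | hj
  · omega
  · exact (Finset.mem_Ico.1 (Finset.mem_filter.1 hj).1).1

lemma exchTerm_congr {t : ℕ} {s : ℤ} (hs : s ∈ holdout n t) {ω : Ω} {ω' : Ω'}
    (hX : ∀ i, -(n : ℤ) ≤ i → X' i ω' = X i ω) (hY : ∀ i, -(n : ℤ) ≤ i → Y' i ω' = Y i ω)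
    (hr : ∀ j, rule' j ω' = rule j ω) :
    exchTerm n α muHat X' Y' rule' t s ω' = exchTerm n α muHat X Y rule t s ω := by
  have hs := (Finset.mem_Ico.1 hs).1
  have hC : calibrationSet n X' (nonadaptivePick rule') t ω' =
      calibrationSet n X (nonadaptivePick rule) t ω := by
    refine Finset.filter_congr fun i hi => ?_
    rw [nonadaptivePick, nonadaptivePick, hr, hX i (Finset.mem_Ico.1 hi).1]
  have he : ∀ i, -(n : ℤ) ≤ i →
      exceeds n α muHat X' Y' rule' t i ω' = exceeds n α muHat X Y rule t i ω := fun i hi =>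
    exceeds_perm (σ := Equiv.refl ℤ) hX hY hC (fun _ => Iff.rfl) hi
  unfold exchTerm Swappable
  rw [hC, he s hs, he t (by omega), hX s hs, hX t (by omega), hr, hr]

/-- Exchanging the data at `s` and `t` changes the sign of the exchangeable contribution. -/
lemma exchTerm_swap {t : ℕ} {s : ℤ} (hs : s ∈ holdout n t) {ω : Ω} {ω' : Ω'}
    (hX : ∀ i, -(n : ℤ) ≤ i → X' i ω' = X (Equiv.swap s t i) ω)
    (hY : ∀ i, -(n : ℤ) ≤ i → Y' i ω' = Y (Equiv.swap s t i) ω)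
    (hr : ∀ j, rule' j ω' = rule j ω) (ht : decision rule X t ω = true)
    (hsw : Swappable X rule t s ω) (hsw' : Swappable X' rule' t s ω') :
    exchTerm n α muHat X' Y' rule' t s ω' = - exchTerm n α muHat X Y rule t s ω := by
  have hs0 := (Finset.mem_Ico.1 hs).1
  have hC : calibrationSet n X' (nonadaptivePick rule') t ω' =
      calibrationSet n X (nonadaptivePick rule) t ω := by
    refine Finset.filter_congr fun i hi => ?_
    rw [holdout, Finset.mem_Ico] at hi
    rw [nonadaptivePick, nonadaptivePick, hr, hX i hi.1]
    -- At index `s` the new feature is `X t`, selected since `S_t = 1`; the old one was selected by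
    -- swappability.
    rcases eq_or_ne i s with rfl | his
    · rw [Equiv.swap_apply_left]
      exact iff_of_true ht hsw.1
    · rw [Equiv.swap_apply_of_ne_of_ne his hi.2.ne]
  have hsC : s ∈ calibrationSet n X (nonadaptivePick rule) t ω := Finset.mem_filter.2 ⟨hs, hsw.1⟩
  have he : ∀ i, -(n : ℤ) ≤ i → exceeds n α muHat X' Y' rule' t i ω' =
      exceeds n α muHat X Y rule t (Equiv.swap s t i) ω := fun i hi =>
    exceeds_perm hX hY hC (fun i => by
      rcases eq_or_ne i s with rfl | his
      · simp [hsC]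
      · rcases eq_or_ne i t with rfl | hit
        · simp [hsC]
        · rw [Equiv.swap_apply_of_ne_of_ne his hit]) hi
  unfold exchTerm
  rw [hC, he s hs0, he t (by omega), Equiv.swap_apply_left, Equiv.swap_apply_right, if_pos hsw,
    if_pos hsw']
  ring

/-- Only times `s` (if `s ≥ 0`) and `t` see a new feature. At `s` the decision is kept by
swappability; at `t` both features are selected. -/
lemma Swappable.rule_eq {g : ∀ t : ℕ, (Fin t → Bool) → Feature d → Bool} (h : DrivenBy g rule X)
    (h' : DrivenBy g rule' X') {t : ℕ} {s : ℤ} {ω : Ω} {ω' : Ω'}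
    (hX : ∀ i, -(n : ℤ) ≤ i → X' i ω' = X (Equiv.swap s t i) ω)
    (ht : decision rule X t ω = true) (hsw : Swappable X rule t s ω) (j : ℕ) :
    rule' j ω' = rule j ω := by
  refine h.rule_eq h' (fun j => ?_) j
  rw [hX j (by omega)]
  rcases eq_or_ne (j : ℤ) s with rfl | hjs
  · rw [Equiv.swap_apply_left]
    exact hsw.2 (by omega)
  · rcases eq_or_ne (j : ℤ) t with hjt | hjt
    · rw [hjt, Equiv.swap_apply_right]
      obtain rfl : j = t := by exact_mod_cast hjt
      exact hsw.1.trans ht.symm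
    · rw [Equiv.swap_apply_of_ne_of_ne hjs hjt]

/-- With the rules unchanged, the joint condition is symmetric in `s` and `t`. -/
lemma Swappable.swap {t : ℕ} {s : ℤ} (hs : s ∈ holdout n t) {ω : Ω} {ω' : Ω'}
    (hX : ∀ i, -(n : ℤ) ≤ i → X' i ω' = X (Equiv.swap s t i) ω)
    (hr : ∀ j, rule' j ω' = rule j ω)
    (ht : decision rule X t ω = true) (hsw : Swappable X rule t s ω) :
    decision rule' X' t ω' = true ∧ Swappable X' rule' t s ω' := by
  have h1 := hX s (Finset.mem_Ico.1 hs).1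
  have h2 := hX t (by omega)
  rw [Equiv.swap_apply_left] at h1
  rw [Equiv.swap_apply_right] at h2
  unfold Swappable decision
  rw [hr, hr, h1, h2]
  exact ⟨hsw.1, ht, fun h => (hsw.2 h).symm⟩

end Exchange

/-! ### Measurability -/

section Measurability

variable {Ω : Type*} [MeasurableSpace Ω] {d : ℕ} {n : ℕ} {α : ℝ} {muHat : Feature d → ℝ}
  {X : ℤ → Ω → Feature d} {Y : ℤ → Ω → ℝ} {rule : ℕ → Ω → Feature d → Bool}

lemma measurable_ind : Measurable ind := measurable_of_finite _

lemma measurable_residual (hmuHat : Measurable muHat) {i : ℤ} (hX : Measurable (X i))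
    (hY : Measurable (Y i)) : Measurable (residual muHat X Y i) :=
  (hY.sub (hmuHat.comp hX)).abs

lemma measurable_card_calibrationSet {t : ℕ}
    (hr : ∀ s : ℤ, -(n : ℤ) ≤ s → Measurable (fun ω => rule t ω (X s ω))) :
    Measurable (fun ω => (calibrationSet n X (nonadaptivePick rule) t ω).card) := by
  have h : ∀ ω, (calibrationSet n X (nonadaptivePick rule) t ω).card =
      ∑ s ∈ holdout n t, if rule t ω (X s ω) = true then 1 else 0 := fun ω =>
    Finset.card_filter _ _
  simp only [h]
  refine Finset.measurable_fun_sum _ fun s hs => ?_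
  exact Measurable.ite (hr s (Finset.mem_Ico.1 hs).1 (measurableSet_singleton true))
    measurable_const measurable_const

lemma measurable_exceeds (hmuHat : Measurable muHat) (hX : ∀ i, -(n : ℤ) ≤ i → Measurable (X i))
    (hY : ∀ i, -(n : ℤ) ≤ i → Measurable (Y i)) {t : ℕ}
    (hr : ∀ s : ℤ, -(n : ℤ) ≤ s → Measurable (fun ω => rule t ω (X s ω)))
    {i : ℤ} (hi : -(n : ℤ) ≤ i) : Measurable (exceeds n α muHat X Y rule t i) := by
  have hR : ∀ i, -(n : ℤ) ≤ i → Measurable (residual muHat X Y i) := fun i hi =>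
    measurable_residual hmuHat (hX i hi) (hY i hi)
  unfold exceeds
  -- Passing to counts avoids proving that the random order statistic is measurable.
  simp only [gt_iff_lt, lt_kthSmallest_iff]
  refine Measurable.ite ?_ measurable_const measurable_const
  refine measurableSet_le ((measurable_from_top (f := conformalRank α)).comp
    (measurable_card_calibrationSet hr)) ?_
  simp only [Finset.card_filter]
  have h : ∀ ω, (∑ j ∈ insert (t : ℤ) (calibrationSet n X (nonadaptivePick rule) t ω),
      if residual muHat X Y j ω < residual muHat X Y i ω then 1 else 0) =
      (if residual muHat X Y t ω < residual muHat X Y i ω then 1 else 0) +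
      ∑ j ∈ holdout n t, if rule t ω (X j ω) = true then
        (if residual muHat X Y j ω < residual muHat X Y i ω then 1 else 0) else 0 := by
    intro ω
    rw [Finset.sum_insert (not_mem_calibrationSet n X rule t ω), calibrationSet, Finset.sum_filter]
    rfl
  simp only [h]
  refine Measurable.add (Measurable.ite (measurableSet_lt (hR t (by omega)) (hR i hi))
    measurable_const measurable_const) (Finset.measurable_fun_sum _ fun j hj => ?_)
  have hj := (Finset.mem_Ico.1 hj).1
  exact Measurable.ite (hr j hj (measurableSet_singleton true))
    (Measurable.ite (measurableSet_lt (hR j hj) (hR i hi)) measurable_const measurable_const)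
    measurable_const

lemma measurable_exchTerm (hmuHat : Measurable muHat) (hX : ∀ i, -(n : ℤ) ≤ i → Measurable (X i))
    (hY : ∀ i, -(n : ℤ) ≤ i → Measurable (Y i))
    (hr : ∀ (t : ℕ) (s : ℤ), -(n : ℤ) ≤ s → Measurable (fun ω => rule t ω (X s ω)))
    {t : ℕ} {s : ℤ} (hs : s ∈ holdout n t) : Measurable (exchTerm n α muHat X Y rule t s) := by
  have hs := (Finset.mem_Ico.1 hs).1
  unfold exchTerm
  refine Measurable.mul (Measurable.div ?_ ?_) (Measurable.sub
    (measurable_exceeds hmuHat hX hY (hr t) (by omega)) (measurable_exceeds hmuHat hX hY (hr t) hs))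
  · refine Measurable.ite ?_ measurable_const measurable_const
    unfold Swappable
    refine MeasurableSet.inter (hr t s hs (measurableSet_singleton true)) ?_
    by_cases h0 : 0 ≤ s
    · simp only [h0, true_imp_iff]
      exact measurableSet_eq_fun (hr _ _ (by omega)) (hr _ _ hs)
    · simp only [h0, false_imp_iff]
      exact MeasurableSet.univ
  · exact (measurable_from_top.comp (measurable_card_calibrationSet (hr t))).add_const 1

lemma measurable_errorTerm (hmuHat : Measurable muHat) (hX : ∀ i, -(n : ℤ) ≤ i → Measurable (X i))
    (hY : ∀ i, -(n : ℤ) ≤ i → Measurable (Y i))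
    (hr : ∀ (t : ℕ) (s : ℤ), -(n : ℤ) ≤ s → Measurable (fun ω => rule t ω (X s ω)))
    (t : ℕ) : Measurable (errorTerm n α muHat X Y rule t) := by
  change Measurable fun ω => errorTerm n α muHat X Y rule t ω
  simp only [errorTerm_eq]
  refine Finset.measurable_fun_sum _ fun s _ => ?_
  refine Measurable.mul (Measurable.div (Measurable.mul ?_ ?_) ?_) (Measurable.sub
    (measurable_exceeds hmuHat hX hY (hr t) (by omega))
    (measurable_exceeds hmuHat hX hY (hr t) (by omega)))
  · exact measurable_ind.comp (hr t s (by omega))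
  · exact Measurable.ite (measurableSet_eq_fun (hr _ _ (by omega)) (hr _ _ (by omega))).compl
      measurable_const measurable_const
  · exact (measurable_from_top.comp (measurable_card_calibrationSet (hr t))).add_const 1

end Measurability

/-! ### Bounds for integrability -/

section Bounds

variable {Ω : Type*} {d : ℕ} {n : ℕ} {α : ℝ} {muHat : Feature d → ℝ}
  {X : ℤ → Ω → Feature d} {Y : ℤ → Ω → ℝ} {rule : ℕ → Ω → Feature d → Bool}

lemma abs_exceeds_sub_le (t : ℕ) (i j : ℤ) (ω : Ω) :
    |exceeds n α muHat X Y rule t i ω - exceeds n α muHat X Y rule t j ω| ≤ 1 := by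
  have h1 := exceeds_nonneg n α muHat X Y rule t i ω
  have h2 := exceeds_le_one n α muHat X Y rule t i ω
  have h3 := exceeds_nonneg n α muHat X Y rule t j ω
  have h4 := exceeds_le_one n α muHat X Y rule t j ω
  rw [abs_le]
  constructor <;> linarith

lemma abs_div_mul_le_one {a c e : ℝ} (ha0 : 0 ≤ a) (ha1 : a ≤ 1) (hc : 0 ≤ c) (he : |e| ≤ 1) :
    |a / (c + 1) * e| ≤ 1 := by
  rw [abs_mul, abs_of_nonneg (by positivity : 0 ≤ a / (c + 1))]
  refine mul_le_one₀ ?_ (abs_nonneg _) he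
  rw [div_le_one (by positivity)]
  linarith

lemma abs_exchTerm_le (t : ℕ) (s : ℤ) (ω : Ω) : |exchTerm n α muHat X Y rule t s ω| ≤ 1 := by
  unfold exchTerm
  refine abs_div_mul_le_one ?_ ?_ (by positivity) (abs_exceeds_sub_le t _ _ ω) <;>
    split_ifs <;> norm_num

lemma abs_errorTerm_le (t : ℕ) (ω : Ω) : |errorTerm n α muHat X Y rule t ω| ≤ t := by
  have h : |errorTerm n α muHat X Y rule t ω| ≤ ∑ s ∈ Finset.range t, (1 : ℝ) := by
    refine (Finset.abs_sum_le_sum_abs _ _).trans (Finset.sum_le_sum fun s _ => ?_)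
    refine abs_div_mul_le_one ?_ ?_ (by positivity) (abs_exceeds_sub_le t t s ω)
    · exact mul_nonneg (ind_nonneg _) (by split_ifs <;> norm_num)
    · exact mul_le_one₀ (ind_le_one _) (by split_ifs <;> norm_num) (by split_ifs <;> norm_num)
  simpa using h

end Bounds


/-- The index `i` clamped to the range `≥ -n`. -/
def clampIndex (n : ℕ) (i : ℤ) : Set.Ici (-(n : ℤ)) :=
  ⟨max i (-(n : ℤ)), Set.mem_Ici.2 (le_max_right _ _)⟩

lemma clampIndex_of_le {n : ℕ} {i : ℤ} (hi : -(n : ℤ) ≤ i) : clampIndex n i = ⟨i, hi⟩ :=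
  Subtype.ext (show max i (-(n : ℤ)) = i from max_eq_left hi)

/-- Both families are independent with the same marginals, and these determine the joint law. -/
lemma identDistrib_perm {Ω ι E : Type*} [MeasurableSpace Ω] {μ : Measure Ω} [Countable ι]
    [MeasurableSpace E] {Z : ι → Ω → E}
    (hindep : iIndepFun Z μ) (hident : ∀ i j, IdentDistrib (Z i) (Z j) μ μ)
    (σ : Equiv.Perm ι) :
    IdentDistrib (fun ω i => Z i ω) (fun ω i => Z (σ i) ω) μ μ :=
  IdentDistrib.pi (fun i => hident i (σ i)) hindep (hindep.precomp σ.injective)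

/-! ### Cancellation in expectation -/

section Integral

variable {Ω : Type*} [MeasurableSpace Ω] {μ : Measure Ω}
  {d n : ℕ} {α : ℝ} {muHat : Feature d → ℝ} {X : ℤ → Ω → Feature d} {Y : ℤ → Ω → ℝ}
  {rule : ℕ → Ω → Feature d → Bool} {g : ∀ t : ℕ, (Fin t → Bool) → Feature d → Bool}

/-- The exchangeable contributions have mean zero, also when weighted by the decisions. -/
lemma integral_exchTerm_eq_zero (hmuHat : Measurable muHat)
    (hindep : iIndepFun (fun (i : Set.Ici (-(n : ℤ))) (ω : Ω) => (X i ω, Y i ω)) μ)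
    (hident : ∀ i : ℤ, -(n : ℤ) ≤ i →
      IdentDistrib (fun ω => (X i ω, Y i ω)) (fun ω => (X 0 ω, Y 0 ω)) μ μ)
    (hg : ∀ t b, Measurable (g t b)) (hdr : DrivenBy g rule X)
    {v : (ℕ → Bool) → ℝ} (hv : Measurable v) {t : ℕ} {s : ℤ} (hs : s ∈ holdout n t) :
    ∫ ω, v (fun j => decision rule X j ω) *
      (ind (decision rule X t ω) * exchTerm n α muHat X Y rule t s ω) ∂μ = 0 := by
  have hs0 := (Finset.mem_Ico.1 hs).1
  -- The swap acts on the space of data sequences. The rules are regenerated there by `replayRule`;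
  -- coordinates below `-n` are arbitrary and never compared.
  let X' : ℤ → (Set.Ici (-(n : ℤ)) → Feature d × ℝ) → Feature d := fun i ζ => (ζ (clampIndex n i)).1
  let Y' : ℤ → (Set.Ici (-(n : ℤ)) → Feature d × ℝ) → ℝ := fun i ζ => (ζ (clampIndex n i)).2
  let rule' := replayRule g X'
  have hdr' : DrivenBy g rule' X' := drivenBy_replayRule g X'
  have hX' : ∀ i, Measurable (X' i) := fun i => (measurable_pi_apply _).fst
  have hY' : ∀ i, Measurable (Y' i) := fun i => (measurable_pi_apply _).snd
  have hr' : ∀ (t : ℕ) (s : ℤ), Measurable (fun ζ => rule' t ζ (X' s ζ)) := fun t s =>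
    hdr'.measurable_rule_apply hg (fun t => hX' t) t (hX' s)
  let F : (Set.Ici (-(n : ℤ)) → Feature d × ℝ) → ℝ := fun ζ =>
    v (fun j => decision rule' X' j ζ) *
      (ind (decision rule' X' t ζ) * exchTerm n α muHat X' Y' rule' t s ζ)
  have hF : Measurable F :=
    (hv.comp (measurable_pi_lambda _ fun j => hr' j j)).mul
      ((measurable_ind.comp (hr' t t)).mul (measurable_exchTerm hmuHat (fun i _ => hX' i)
        (fun i _ => hY' i) (fun t s _ => hr' t s) hs))
  let Z : Ω → Set.Ici (-(n : ℤ)) → Feature d × ℝ := fun ω i => (X i ω, Y i ω)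
  have hFZ : ∀ ω, v (fun j => decision rule X j ω) *
      (ind (decision rule X t ω) * exchTerm n α muHat X Y rule t s ω) = F (Z ω) := by
    intro ω
    have h1 : ∀ i, -(n : ℤ) ≤ i → X' i (Z ω) = X i ω := fun i hi => by
      simp only [X', Z, clampIndex_of_le hi]
    have h2 : ∀ i, -(n : ℤ) ≤ i → Y' i (Z ω) = Y i ω := fun i hi => by
      simp only [Y', Z, clampIndex_of_le hi]
    have h3 : ∀ j, rule' j (Z ω) = rule j ω := fun j =>
      hdr.rule_eq hdr' (fun j => by rw [h1 j (by omega)]) j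
    have h4 : ∀ j : ℕ, decision rule' X' j (Z ω) = decision rule X j ω := fun j => by
      rw [decision, decision, h3, h1 j (by omega)]
    simp only [F, h4, exchTerm_congr hs h1 h2 h3]
  let σ : Equiv.Perm (Set.Ici (-(n : ℤ))) := Equiv.swap (clampIndex n s) (clampIndex n t)
  have hσ : ∀ i, -(n : ℤ) ≤ i → σ (clampIndex n i) = clampIndex n (Equiv.swap s t i) := by
    intro i hi
    simp only [σ]
    rcases eq_or_ne i s with rfl | his
    · simp
    · rcases eq_or_ne i t with rfl | hit
      · simp
      · rw [Equiv.swap_apply_of_ne_of_ne his hit, Equiv.swap_apply_of_ne_of_ne]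
        · rw [clampIndex_of_le hi, clampIndex_of_le hs0]
          exact fun h => his (congrArg Subtype.val h)
        · rw [clampIndex_of_le hi, clampIndex_of_le (by omega : -(n : ℤ) ≤ (t : ℤ))]
          exact fun h => hit (congrArg Subtype.val h)
  have hXσ : ∀ ζ i, -(n : ℤ) ≤ i → X' i (fun k => ζ (σ k)) = X' (Equiv.swap s t i) ζ :=
    fun ζ i hi => by simp only [X', hσ i hi]
  have hYσ : ∀ ζ i, -(n : ℤ) ≤ i → Y' i (fun k => ζ (σ k)) = Y' (Equiv.swap s t i) ζ :=
    fun ζ i hi => by simp only [Y', hσ i hi]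
  have hpos : ∀ ζ, decision rule' X' t ζ = true → Swappable X' rule' t s ζ →
      decision rule' X' t (fun k => ζ (σ k)) = true ∧ Swappable X' rule' t s (fun k => ζ (σ k)) ∧
        F (fun k => ζ (σ k)) = - F ζ := by
    intro ζ ht hsw
    have hrule := hsw.rule_eq (n := n) (ω' := fun k => ζ (σ k)) hdr' hdr' (hXσ ζ) ht
    obtain ⟨ht', hsw'⟩ := hsw.swap hs (hXσ ζ) hrule ht
    have hdec : ∀ j : ℕ, decision rule' X' j (fun k => ζ (σ k)) = decision rule' X' j ζ := by
      intro j
      unfold decision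
      rw [hrule, hXσ ζ j (by omega)]
      rcases eq_or_ne (j : ℤ) s with rfl | hjs
      · rw [Equiv.swap_apply_left]
        exact hsw.2 (by omega)
      · rcases eq_or_ne (j : ℤ) t with hjt | hjt
        · rw [hjt, Equiv.swap_apply_right]
          obtain rfl : j = t := by exact_mod_cast hjt
          exact hsw.1.trans ht.symm
        · rw [Equiv.swap_apply_of_ne_of_ne hjs hjt]
    refine ⟨ht', hsw', ?_⟩
    simp only [F, hdec, exchTerm_swap hs (hXσ ζ) (hYσ ζ) hrule ht hsw hsw', mul_neg]
  -- `F` is odd under the swap: `hpos` covers the swappable event, and off it both sides vanish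
  -- because the swap is an involution preserving that event.
  have hneg : ∀ ζ, F (fun k => ζ (σ k)) = - F ζ := by
    intro ζ
    have hzero : ∀ ζ, ¬ (decision rule' X' t ζ = true ∧ Swappable X' rule' t s ζ) → F ζ = 0 := by
      intro ζ h
      by_cases ht : decision rule' X' t ζ = true
      · have hsw : ¬ Swappable X' rule' t s ζ := fun h' => h ⟨ht, h'⟩
        simp [F, exchTerm, hsw]
      · simp [F, ind, ht]
    by_cases h : decision rule' X' t ζ = true ∧ Swappable X' rule' t s ζ
    · exact (hpos ζ h.1 h.2).2.2
    · have h' : ¬ (decision rule' X' t (fun k => ζ (σ k)) = true ∧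
          Swappable X' rule' t s (fun k => ζ (σ k))) := by
        intro h'
        have h2 := hpos _ h'.1 h'.2
        have hinv : (fun k => (fun k => ζ (σ k)) (σ k)) = ζ := by
          funext k
          simp [σ]
        rw [hinv] at h2
        exact h ⟨h2.1, h2.2.1⟩
      rw [hzero _ h, hzero _ h', neg_zero]
  have hid : IdentDistrib Z (fun ω i => Z ω (σ i)) μ μ :=
    identDistrib_perm hindep (fun i j => (hident i i.2).trans (hident j j.2).symm) σ
  -- Invariance in law and oddness give `E F(Z) = -E F(Z)`.
  have hint := (hid.comp hF).integral_eq
  simp only [Function.comp_def] at hint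
  have h1 : ∀ ω, F (fun i => Z ω (σ i)) = - F (Z ω) := fun ω => hneg (Z ω)
  simp only [h1, integral_neg] at hint
  simp only [hFZ]
  linarith

lemma integrable_of_measurable_of_abs_le [IsFiniteMeasure μ] {f : Ω → ℝ} (hf : Measurable f) (c : ℝ)
    (h : ∀ ω, |f ω| ≤ c) : Integrable f μ :=
  Integrable.of_bound hf.aestronglyMeasurable c (Filter.Eventually.of_forall h)

/-- The miscoverage at time `t`, weighted by a function of the decisions. -/
lemma integral_exceeds_le [IsFiniteMeasure μ] (hα0 : 0 ≤ α) (hmuHat : Measurable muHat)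
    (hX : ∀ i : ℤ, -(n : ℤ) ≤ i → Measurable (X i)) (hY : ∀ i : ℤ, -(n : ℤ) ≤ i → Measurable (Y i))
    (hindep : iIndepFun (fun (i : Set.Ici (-(n : ℤ))) (ω : Ω) => (X i ω, Y i ω)) μ)
    (hident : ∀ i : ℤ, -(n : ℤ) ≤ i →
      IdentDistrib (fun ω => (X i ω, Y i ω)) (fun ω => (X 0 ω, Y 0 ω)) μ μ)
    (hg : ∀ t b, Measurable (g t b)) (hdr : DrivenBy g rule X)
    {v : (ℕ → Bool) → ℝ} (hv : Measurable v) (hv0 : ∀ b, 0 ≤ v b) (hv1 : ∀ b, v b ≤ 1) (t : ℕ) :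
    Integrable (fun ω => v (fun j => decision rule X j ω) *
        (ind (decision rule X t ω) * exceeds n α muHat X Y rule t t ω)) μ ∧
    Integrable (fun ω => v (fun j => decision rule X j ω) * ind (decision rule X t ω)) μ ∧
    Integrable (fun ω => v (fun j => decision rule X j ω) *
        (ind (decision rule X t ω) * errorTerm n α muHat X Y rule t ω)) μ ∧
    ∫ ω, v (fun j => decision rule X j ω) *
        (ind (decision rule X t ω) * exceeds n α muHat X Y rule t t ω) ∂μ ≤
      α * ∫ ω, v (fun j => decision rule X j ω) * ind (decision rule X t ω) ∂μ +
        ∫ ω, v (fun j => decision rule X j ω) *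
          (ind (decision rule X t ω) * errorTerm n α muHat X Y rule t ω) ∂μ := by
  have hr : ∀ (t : ℕ) (s : ℤ), -(n : ℤ) ≤ s → Measurable (fun ω => rule t ω (X s ω)) :=
    fun t s hs => hdr.measurable_rule_apply hg (fun t => hX t (by omega)) t (hX s hs)
  have hvm : Measurable fun ω => v (fun j => decision rule X j ω) :=
    hv.comp (measurable_pi_lambda _ fun j => hr j j (by omega))
  have him : Measurable fun ω => ind (decision rule X t ω) :=
    measurable_ind.comp (hr t t (by omega))
  have hint : ∀ (f : Ω → ℝ) (c : ℝ), Measurable f → (∀ ω, |f ω| ≤ c) →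
      Integrable (fun ω => v (fun j => decision rule X j ω) *
        (ind (decision rule X t ω) * f ω)) μ := by
    intro f c hf hc
    refine integrable_of_measurable_of_abs_le (hvm.mul (him.mul hf)) c fun ω => ?_
    rw [abs_mul, abs_mul, abs_of_nonneg (hv0 _), abs_of_nonneg (ind_nonneg _), ← mul_assoc]
    exact (mul_le_of_le_one_left (abs_nonneg _)
      (mul_le_one₀ (hv1 _) (ind_nonneg _) (ind_le_one _))).trans (hc ω)
  have hint1 := hint (exceeds n α muHat X Y rule t t) 1
    (measurable_exceeds hmuHat hX hY (hr t) (by omega)) fun ω => by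
      rw [abs_of_nonneg (exceeds_nonneg _ _ _ _ _ _ _ _ _)]
      exact exceeds_le_one _ _ _ _ _ _ _ _ _
  have hint2 := hint (fun _ => α) |α| measurable_const fun ω => le_rfl
  have hint3 := hint _ t (measurable_errorTerm (α := α) hmuHat hX hY hr t) (abs_errorTerm_le t)
  have hint4 : ∀ s ∈ holdout n t, Integrable (fun ω => v (fun j => decision rule X j ω) *
      (ind (decision rule X t ω) * exchTerm n α muHat X Y rule t s ω)) μ := fun s hs =>
    hint _ 1 (measurable_exchTerm hmuHat hX hY hr hs) (abs_exchTerm_le t s)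
  refine ⟨hint1, by simpa using hint (fun _ => 1) 1 measurable_const (by simp), hint3, ?_⟩
  calc ∫ ω, v (fun j => decision rule X j ω) *
        (ind (decision rule X t ω) * exceeds n α muHat X Y rule t t ω) ∂μ
      ≤ ∫ ω, (v (fun j => decision rule X j ω) * (ind (decision rule X t ω) * α) +
          v (fun j => decision rule X j ω) *
            (ind (decision rule X t ω) * errorTerm n α muHat X Y rule t ω) +
          ∑ s ∈ holdout n t, v (fun j => decision rule X j ω) *
            (ind (decision rule X t ω) * exchTerm n α muHat X Y rule t s ω)) ∂μ := by
        refine integral_mono hint1 ((hint2.add hint3).add (integrable_finsetSum _ hint4))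
          fun ω => ?_
        dsimp only
        rw [← Finset.mul_sum, ← Finset.mul_sum, ← mul_add, ← mul_add, ← mul_add, ← mul_add]
        exact mul_le_mul_of_nonneg_left (mul_le_mul_of_nonneg_left
          (exceeds_le n α muHat X Y rule hα0 t ω) (ind_nonneg _)) (hv0 _)
    _ = _ := by
        have h := integral_add (hint2.add hint3) (integrable_finsetSum _ hint4)
        simp only [Pi.add_apply] at h
        rw [h, integral_add hint2 hint3, integral_finsetSum _ hint4,
          Finset.sum_eq_zero fun s hs =>
            integral_exchTerm_eq_zero hmuHat hindep hident hg hdr hv hs,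
          add_zero, ← integral_const_mul]
        congr 2
        funext ω
        ring

end Integral

end CAP

end

/-! ### The two bounds -/

theorem mainTheorem6 {Ω : Type*} [MeasurableSpace Ω] (μ : Measure Ω) [IsProbabilityMeasure μ]
    (d n : ℕ) (α : ℝ) (hα0 : 0 < α) (hα1 : α < 1)
    -- the pre-trained model
    (muHat : CAP.Feature d → ℝ) (hmuHat : Measurable muHat)
    -- the i.i.d. data `(X_i, Y_i)`, `i ≥ -n`
    (X : ℤ → Ω → CAP.Feature d) (Y : ℤ → Ω → ℝ)
    (hX : ∀ i : ℤ, -(n : ℤ) ≤ i → Measurable (X i))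
    (hY : ∀ i : ℤ, -(n : ℤ) ≤ i → Measurable (Y i))
    (hindep : iIndepFun (fun (i : Set.Ici (-(n : ℤ))) (ω : Ω) => (X i ω, Y i ω)) μ)
    (hident : ∀ i : ℤ, -(n : ℤ) ≤ i →
      IdentDistrib (fun ω => (X i ω, Y i ω)) (fun ω => (X 0 ω, Y 0 ω)) μ μ)
    -- the decision-driven selection rules, independent of the initial labeled data
    (rule : ℕ → Ω → CAP.Feature d → Bool)
    (hrule : ∀ t ω, Measurable (rule t ω))
    (hdriven : CAP.DecisionDriven rule X)
    (hinit : CAP.IndepOfInitial μ n X Y rule) :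
    (∀ T : ℕ,
      CAP.FCR μ rule X Y (CAP.interval n α muHat X Y (CAP.nonadaptivePick rule)) T ≤
        α + ∑ t ∈ Finset.range (T + 1),
          ∫ ω, CAP.ind (CAP.decision rule X t ω) * CAP.errorTerm n α muHat X Y rule t ω /
            max 1 (∑ j ∈ Finset.range (T + 1), CAP.ind (CAP.decision rule X j ω)) ∂μ) ∧
    (∀ t : ℕ, 0 < μ {ω | CAP.decision rule X t ω = true} →
      1 - α - (∫ ω, CAP.ind (CAP.decision rule X t ω) *
            CAP.errorTerm n α muHat X Y rule t ω ∂μ) /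
          μ.real {ω | CAP.decision rule X t ω = true} ≤
        (μ[|{ω | CAP.decision rule X t ω = true}]).real
          {ω | Y t ω ∈ CAP.interval n α muHat X Y (CAP.nonadaptivePick rule) t ω}) := by
  classical
  obtain ⟨g, hg, hdr⟩ := hdriven.exists_drivenBy hrule
  constructor
  · intro T
    -- The FCR denominator includes decisions after time `t`; this is harmless, as the swap
    -- preserves all of them.
    let v : (ℕ → Bool) → ℝ := fun b => (max 1 (∑ j ∈ Finset.range (T + 1), CAP.ind (b j)))⁻¹
    have hv : Measurable v := by
      refine (measurable_const.max (Finset.measurable_fun_sum _ fun j _ => ?_)).inv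
      exact CAP.measurable_ind.comp (measurable_pi_apply j)
    have hv0 : ∀ b, 0 ≤ v b := fun b => inv_nonneg.2 (zero_le_one.trans (le_max_left _ _))
    have hv1 : ∀ b, v b ≤ 1 := fun b => inv_le_one_of_one_le₀ (le_max_left _ _)
    have key := CAP.integral_exceeds_le hα0.le hmuHat hX hY hindep hident hg hdr hv hv0 hv1
    have h1 : ∀ t, ∫ ω, CAP.ind (CAP.decision rule X t ω) * CAP.errorTerm n α muHat X Y rule t ω /
            max 1 (∑ j ∈ Finset.range (T + 1), CAP.ind (CAP.decision rule X j ω)) ∂μ =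
        ∫ ω, v (fun j => CAP.decision rule X j ω) *
          (CAP.ind (CAP.decision rule X t ω) * CAP.errorTerm n α muHat X Y rule t ω) ∂μ := by
      intro t
      simp only [v, div_eq_inv_mul]
    have h2 : CAP.FCR μ rule X Y (CAP.interval n α muHat X Y (CAP.nonadaptivePick rule)) T =
        ∑ t ∈ Finset.range (T + 1), ∫ ω, v (fun j => CAP.decision rule X j ω) *
          (CAP.ind (CAP.decision rule X t ω) * CAP.exceeds n α muHat X Y rule t t ω) ∂μ := by
      rw [← integral_finsetSum _ fun t _ => (key t).1]
      unfold CAP.FCR CAP.FCP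
      simp only [v, div_eq_inv_mul, Finset.mul_sum, CAP.exceeds_self_eq]
    -- The weights `v S_t` sum to at most one, so the contributions of `α` add up to at most `α`.
    have h3 : ∑ t ∈ Finset.range (T + 1), ∫ ω, v (fun j => CAP.decision rule X j ω) *
          CAP.ind (CAP.decision rule X t ω) ∂μ ≤ 1 := by
      rw [← integral_finsetSum _ fun t _ => (key t).2.1]
      calc _ ≤ ∫ _, (1 : ℝ) ∂μ := by
            refine integral_mono (integrable_finsetSum _ fun t _ => (key t).2.1)
              (integrable_const 1) fun ω => ?_
            dsimp only
            rw [← Finset.mul_sum]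
            exact inv_mul_le_one_of_le₀ (le_max_right _ _) (zero_le_one.trans (le_max_left _ _))
        _ = 1 := by simp
    simp only [h1, h2]
    refine (Finset.sum_le_sum fun t _ => (key t).2.2.2).trans ?_
    rw [Finset.sum_add_distrib, ← Finset.mul_sum]
    nlinarith
  · intro t ht
    have hr : ∀ (t : ℕ) (s : ℤ), -(n : ℤ) ≤ s → Measurable (fun ω => rule t ω (X s ω)) :=
      fun t s hs => hdr.measurable_rule_apply hg (fun t => hX t (by omega)) t (hX s hs)
    set A : Set Ω := {ω | CAP.decision rule X t ω = true}
    have hA : MeasurableSet A := hr t t (by omega) (measurableSet_singleton true)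
    set B : Set Ω := {ω | Y t ω ∈ CAP.interval n α muHat X Y (CAP.nonadaptivePick rule) t ω}
    have hB : MeasurableSet B := by
      simp only [B, CAP.mem_interval_iff]
      exact CAP.measurable_exceeds hmuHat hX hY (hr t) (by omega) (measurableSet_singleton 0)
    -- With weight one this becomes `μ(A \ B) ≤ α μ(A) + E[S_t Δ_t]`, to be divided by `μ(A)`.
    have key := (CAP.integral_exceeds_le hα0.le hmuHat hX hY hindep hident hg hdr
      (v := fun _ => 1) measurable_const (fun _ => zero_le_one) (fun _ => le_rfl) t).2.2.2
    simp only [one_mul] at key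
    have h1 : ∫ ω, CAP.ind (CAP.decision rule X t ω) ∂μ = μ.real A := by
      rw [← integral_indicator_one hA]
      congr 1
      funext ω
      by_cases h : CAP.decision rule X t ω = true <;> simp [Set.indicator, A, CAP.ind, h]
    have h2 : ∫ ω, CAP.ind (CAP.decision rule X t ω) * CAP.exceeds n α muHat X Y rule t t ω ∂μ =
        μ.real (A \ B) := by
      rw [← integral_indicator_one (hA.diff hB)]
      congr 1
      funext ω
      rw [CAP.exceeds_self_eq]
      by_cases h1 : CAP.decision rule X t ω = true <;>
        by_cases h2 : Y t ω ∈ CAP.interval n α muHat X Y (CAP.nonadaptivePick rule) t ω <;>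
        simp [Set.indicator, A, B, CAP.ind, h1, h2]
    have hpos : 0 < μ.real A := ENNReal.toReal_pos ht.ne' (measure_ne_top _ _)
    have h3 : μ.real (A ∩ B) + μ.real (A \ B) = μ.real A := measureReal_inter_add_sdiff hB
    rw [h1, h2] at key
    have h4 : (μ[|A]).real B = (μ.real A)⁻¹ * μ.real (A ∩ B) := by
      rw [measureReal_def, cond_apply hA, ENNReal.toReal_mul, ENNReal.toReal_inv, ← measureReal_def,
        ← measureReal_def]
    rw [h4, inv_mul_eq_div, sub_le_iff_le_add, ← add_div, le_div_iff₀ hpos]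
    linarith
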